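/- Let $p_0,p_1\in(0,1)$ satisfy $p_0+p_1<1$, and let $\eta=(\eta_n)_{n\in\mathbb{Z}}$ be the two-sided stationary Markov chain on $\{0,1\}$ with transition probabilities $\mathbf{P}(\eta_{n+1}=1\mid\eta_n=j)=p_j$, $j\in\{0,1\}$. The path encoding of a configuration $\eta\in\{0,1\}^{\mathbb{Z}}$ is the path $S:\mathbb{Z}\to\mathbb{Z}$ with $S_0=0$ and $S_n-S_{n-1}=1-2\eta_n$ for all $n\in\mathbb{Z}$. For a path $S$ with $\sup_{m\le 0}S_m<\infty$, set $M_n=\sup_{m\le n}S_m$ and $(TS)_n=2M_n-S_n-2M_0$ for $n\in\mathbb{Z}$. Let $\mathrm{LM}(S)=\{n\in\mathbb{Z}: S_{n-1}<S_n>S_{n+1}\}$ be the set of local maxima of $S$, let $\tau(S)=\inf\{n\ge 0: n\in\mathrm{LM}(S)\}$, let $(\theta^tS)_s=S_{t+s}-S_t$ for $s,t\in\mathbb{Z}$, and define $$\mathcal{T}S=\theta^{\tau(TS)}(TS).$$ Let $S$ be the path encoding of the Markov chain $\eta$. Then the event $\{0\in\mathrm{LM}(S)\}=\{\eta_0=0,\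 \eta_1=1\}$ has positive probability. Let $\eta^*$ be a random configuration whose law is the conditional law of $\eta$ given this event, and let $S^*$ be its path encoding. Then, almost surely, $\mathcal{T}S^*$ is well-defined (that is, $\sup_{m\le0}S^*_m<\infty$ and $\tau(TS^*)<\infty$), and $$\mathcal{T}S^*\buildrel{d}\over{=}S^*.$$ -/

import Mathlib

open MeasureTheory ProbabilityTheory

namespace BoxBall

/-- A two-sided particle configuration `η ∈ {0,1}^ℤ`; `η n = 1` means that there is a
particle at site `n`. -/
abbrev Config : Type := ℤ → Fin 2

/-- The path encoding `S` of `η`: the path with `S 0 = 0` and `S n - S (n-1) = 1 - 2 η n`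
for every `n ∈ ℤ` (see `pathEncoding_zero` and `pathEncoding_sub`). -/
noncomputable def pathEncoding (η : Config) (n : ℤ) : ℤ :=
  (∑ k ∈ Finset.Ioc 0 n, (1 - 2 * ((η k : ℕ) : ℤ))) -
    ∑ k ∈ Finset.Ioc n 0, (1 - 2 * ((η k : ℕ) : ℤ))

theorem pathEncoding_zero (η : Config) : pathEncoding η 0 = 0 := by
  simp [pathEncoding]

theorem pathEncoding_sub (η : Config) (n : ℤ) :
    pathEncoding η n - pathEncoding η (n - 1) = 1 - 2 * ((η n : ℕ) : ℤ) := by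
  unfold pathEncoding
  rcases le_or_gt 1 n with h | h
  · have h1 : Finset.Ioc 0 n = insert n (Finset.Ioc 0 (n - 1)) := by
      ext k; simp only [Finset.mem_Ioc, Finset.mem_insert]; omega
    have h2 : Finset.Ioc n 0 = ∅ := by
      ext k; simp only [Finset.mem_Ioc, Finset.notMem_empty, iff_false]; omega
    have h3 : Finset.Ioc (n - 1) 0 = ∅ := by
      ext k; simp only [Finset.mem_Ioc, Finset.notMem_empty, iff_false]; omega
    rw [h1, h2, h3, Finset.sum_insert (by simp)]
    simp
  · have h1 : Finset.Ioc (n - 1) 0 = insert n (Finset.Ioc n 0) := by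
      ext k; simp only [Finset.mem_Ioc, Finset.mem_insert]; omega
    have h2 : Finset.Ioc 0 n = ∅ := by
      ext k; simp only [Finset.mem_Ioc, Finset.notMem_empty, iff_false]; omega
    have h3 : Finset.Ioc 0 (n - 1) = ∅ := by
      ext k; simp only [Finset.mem_Ioc, Finset.notMem_empty, iff_false]; omega
    rw [h1, h2, h3, Finset.sum_insert (by simp)]
    simp

/-- The past maximum `M n = sup_{m ≤ n} S m`, meaningful when `S` is bounded above on
`(-∞, n]`. -/
noncomputable def pastMax (S : ℤ → ℤ) (n : ℤ) : ℤ := sSup (S '' Set.Iic n)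

/-- The box-ball dynamics on path encodings (reflection in the past maximum):
`(TS) n = 2 M n - S n - 2 M 0`, meaningful when `M 0 < ∞`. -/
noncomputable def pitman (S : ℤ → ℤ) (n : ℤ) : ℤ := 2 * pastMax S n - S n - 2 * pastMax S 0

/-- The set `LM(S)` of local maxima of a path `S`. -/
def localMaxima (S : ℤ → ℤ) : Set ℤ := {n | S (n - 1) < S n ∧ S (n + 1) < S n}

/-- For a path encoding, `0` is a local maximum if and only if `η 0 = 0` and `η 1 = 1`. -/
theorem zero_mem_localMaxima_iff (η : Config) :
    (0 : ℤ) ∈ localMaxima (pathEncoding η) ↔ η 0 = 0 ∧ η 1 = 1 := by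
  have h0 := pathEncoding_sub η 0
  have h1 := pathEncoding_sub η 1
  simp only [localMaxima, Set.mem_ofPred_eq, Fin.ext_iff, zero_add, sub_self, Fin.val_zero,
    Fin.val_one] at *
  have := (η 0).isLt
  have := (η 1).isLt
  omega

/-- The first nonnegative local maximum, `τ(S) = inf {n ≥ 0 : n ∈ LM(S)}`, meaningful when
this set is nonempty. -/
noncomputable def firstLocalMax (S : ℤ → ℤ) : ℤ := sInf {n : ℤ | 0 ≤ n ∧ n ∈ localMaxima S}

/-- The spatial shift `(θ^t S) s = S (t + s) - S t`. -/
def pathShift (t : ℤ) (S : ℤ → ℤ) (s : ℤ) : ℤ := S (t + s) - S t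

/-- The operator `𝒯 S = θ^{τ(TS)} (TS)`. -/
noncomputable def palmStep (S : ℤ → ℤ) : ℤ → ℤ :=
  pathShift (firstLocalMax (pitman S)) (pitman S)

/-- The transition matrix on `{0,1}` under which the next state is `1` with probability
`p₀` from state `0` and `p₁` from state `1`. -/
def transMatrix (p₀ p₁ : ℝ) : Matrix (Fin 2) (Fin 2) ℝ :=
  !![1 - p₀, p₀; 1 - p₁, p₁]

/-- `η` is a two-sided stationary Markov chain on `{0,1}` with transition matrix `P`. -/
structure IsStationaryMarkov {Ω : Type*} [MeasurableSpace Ω] (μ : Measure Ω)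
    (P : Matrix (Fin 2) (Fin 2) ℝ) (η : Ω → Config) : Prop where
  measurable : Measurable η
  /-- the law of `η` is invariant under spatial shifts -/
  stationary : ∀ m : ℤ, μ.map (fun ω n => η ω (n + m)) = μ.map η
  /-- conditionally on any past `(η (n-k), …, η n) = (x (n-k), …, x n)` of positive
  probability, `η (n+1) = j` has probability `P (x n) j` -/
  markov : ∀ (n : ℤ) (k : ℕ) (x : Config) (j : Fin 2),
    μ {ω | ∀ m ∈ Set.Icc (n - k) n, η ω m = x m} ≠ 0 →
      μ[{ω | η ω (n + 1) = j} | {ω | ∀ m ∈ Set.Icc (n - k) n, η ω m = x m}]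
        = ENNReal.ofReal (P (x n) j)

end BoxBall

/-! The proof has two halves: the law of the chain is invariant under the box-ball dynamics, and
this invariance survives conditioning on a local maximum at the origin.

Let W = M - S be the carrier load, a walk reflected at 0. When the past is bounded, the particles of
η are exactly the up-steps of W, and the particles of the new configuration are its strict
down-steps, that is, the up-steps of W read backwards (`bbs_eq_reverse`). So if W is reversible in
law, the new configuration is distributed as the reversal of η, up to a shift; and the stationary
two-state chain is itself reversible (`map_bbs`). Two consecutive loads reveal the current
occupation number, so W is a second-order Markov chain, and its reversibility reduces to detailed
balance for pairs of neighbouring loads (`map_carrier_seqRev`). The balance identities follow from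
equality of up- and down-crossings of each level. Boundedness of the past is where p₀ + p₁ < 1
enters, through an exponential moment bound (`ae_bddPast`).

For the conditioning, the local maxima of TS are the local minima of S (`bbs_localMax_iff`). From a
local maximum of S at 0, the first local maximum of TS is therefore the end of the particle run
starting at 1. Moving the origin there maps the law restricted to a maximum at 0 onto the law
restricted to a minimum at 0: decompose by run length and use stationarity on each piece. The
dynamics then turns the minimum into a maximum and preserves the law (`map_palmStep`). -/

namespace BoxBall

open scoped ENNReal

/-! ### The carrier load and the dynamics on configurations. -/

/-- The spatial shift of a two-sided sequence. -/
def seqShift {α : Type*} (m : ℤ) (y : ℤ → α) (n : ℤ) : α := y (n + m)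

/-- The reflection of a two-sided sequence at the origin. -/
def seqRev {α : Type*} (y : ℤ → α) (n : ℤ) : α := y (-n)

/-- The step of the path `k ↦ S (n - k)` caused by a site with occupation number `j`. -/
def particleStep (j : Fin 2) : ℤ := 2 * ((j : ℕ) : ℤ) - 1

/-- The backward increment `S (n - k) - S n` of the path encoding. -/
def backInc (y : Config) (n : ℤ) (k : ℕ) : ℤ := ∑ i ∈ Finset.range k, particleStep (y (n - i))

/-- Configurations whose path encoding is bounded above on every left half-line. -/
def BddPast (y : Config) : Prop := ∀ n, BddAbove (Set.range (backInc y n))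

/-- The carrier load `M n - S n`. -/
noncomputable def carrier (y : Config) (n : ℤ) : ℕ := (⨆ k, backInc y n k).toNat

/-- The box-ball dynamics on configurations. -/
noncomputable def bbs (y : Config) (n : ℤ) : Fin 2 := if carrier y n < carrier y (n - 1) then 1 else 0

/-- The carrier load after passing a site with occupation number `j`. -/
def loadStep (w : ℕ) (j : Fin 2) : ℕ := if j = 1 then w + 1 else w - 1

theorem backInc_zero (y : Config) (n : ℤ) : backInc y n 0 = 0 := by simp [backInc]

theorem backInc_succ (y : Config) (n : ℤ) (k : ℕ) :
    backInc y (n + 1) (k + 1) = particleStep (y (n + 1)) + backInc y n k := by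
  unfold backInc
  rw [Finset.sum_range_succ', add_comm]
  congr 1
  · simp
  · refine Finset.sum_congr rfl fun i _ => ?_
    congr 2
    push_cast
    ring

theorem backInc_congr {y z : Config} {n : ℤ} (h : ∀ m ≤ n, y m = z m) (k : ℕ) :
    backInc y n k = backInc z n k :=
  Finset.sum_congr rfl fun i _ => by rw [h _ (by omega)]

theorem carrier_congr {y z : Config} {n : ℤ} (h : ∀ m ≤ n, y m = z m) :
    carrier y n = carrier z n := by
  simp only [carrier, backInc_congr h]

theorem backInc_seqShift (y : Config) (m n : ℤ) (k : ℕ) :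
    backInc (seqShift m y) n k = backInc y (n + m) k :=
  Finset.sum_congr rfl fun i _ => by
    simp only [seqShift]
    congr 2
    ring

theorem carrier_seqShift (y : Config) (m : ℤ) : carrier (seqShift m y) = seqShift m (carrier y) := by
  funext n
  simp only [carrier, backInc_seqShift, seqShift]

theorem bbs_seqShift (y : Config) (m : ℤ) : bbs (seqShift m y) = seqShift m (bbs y) := by
  funext n
  simp only [bbs, carrier_seqShift, seqShift]
  rw [show n - 1 + m = n + m - 1 by ring]

theorem BddPast.isLUB_carrier {y : Config} (hy : BddPast y) (n : ℤ) :
    IsLUB (Set.range (backInc y n)) (carrier y n) := by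
  have h : IsLUB (Set.range (backInc y n)) (⨆ k, backInc y n k) := isLUB_ciSup (hy n)
  have h0 : 0 ≤ ⨆ k, backInc y n k := by
    have := h.1 ⟨0, rfl⟩
    rwa [backInc_zero] at this
  rwa [carrier, Int.toNat_of_nonneg h0]

/-- Lindley recursion: a window ending at `n + 1` is either empty or adds one step to a window
ending at `n`, so the new supremum is `max 0 (step + load)`. Truncated subtraction in `loadStep` is
this reflection at 0. -/
theorem BddPast.carrier_succ {y : Config} (hy : BddPast y) (n : ℤ) :
    carrier y (n + 1) = loadStep (carrier y n) (y (n + 1)) := by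
  have h1 := hy.isLUB_carrier n
  have h2 : IsLUB (Set.range (backInc y (n + 1)))
      (max 0 (particleStep (y (n + 1)) + (carrier y n : ℤ))) := by
    constructor
    · rintro _ ⟨k, rfl⟩
      rcases k with _ | k
      · simp [backInc_zero]
      · have := h1.1 ⟨k, rfl⟩
        rw [backInc_succ]
        exact le_max_of_le_right (by linarith)
    · intro b hb
      refine max_le ?_ ?_
      · have := hb ⟨0, rfl⟩
        rwa [backInc_zero] at this
      · have : (carrier y n : ℤ) ≤ b - particleStep (y (n + 1)) := by
          refine h1.2 ?_
          rintro _ ⟨k, rfl⟩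
          have := hb ⟨k + 1, rfl⟩
          rw [backInc_succ] at this
          linarith
        linarith
  have h3 := (hy.isLUB_carrier (n + 1)).unique h2
  unfold loadStep
  unfold particleStep at h3
  rcases Fin.exists_fin_two.1 ⟨y (n + 1), rfl⟩ with h | h <;> rw [h] at h3 ⊢ <;> simp at h3 ⊢ <;> omega

theorem BddPast.eq_one_iff {y : Config} (hy : BddPast y) (n : ℤ) :
    y n = 1 ↔ carrier y (n - 1) < carrier y n := by
  have h := hy.carrier_succ (n - 1)
  rw [sub_add_cancel] at h
  unfold loadStep at h
  split_ifs at h with h' <;> simp only [h', true_iff, false_iff] <;> omega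

theorem pathEncoding_unique {f : ℤ → ℤ} {y : Config} (h0 : f 0 = 0)
    (h : ∀ n, f n - f (n - 1) = 1 - 2 * ((y n : ℕ) : ℤ)) : f = pathEncoding y := by
  funext n
  induction n using Int.induction_on with
  | zero => rw [h0, pathEncoding_zero]
  | succ i hi =>
    have h1 := h (i + 1)
    have h2 := pathEncoding_sub y (i + 1)
    rw [add_sub_cancel_right] at h1 h2
    linarith
  | pred i hi =>
    have h1 := h (-i)
    have h2 := pathEncoding_sub y (-i)
    linarith

theorem pathShift_pathEncoding (m : ℤ) (y : Config) :
    pathShift m (pathEncoding y) = pathEncoding (seqShift m y) := by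
  refine pathEncoding_unique (by simp [pathShift]) fun n => ?_
  have := pathEncoding_sub y (n + m)
  simp only [pathShift, seqShift]
  rw [← this, add_comm m n, show m + (n - 1) = n + m - 1 by ring]
  ring

theorem pathEncoding_sub_natCast (y : Config) (n : ℤ) (k : ℕ) :
    pathEncoding y (n - k) = pathEncoding y n + backInc y n k := by
  induction k with
  | zero => simp [backInc_zero]
  | succ k ih =>
    have h := pathEncoding_sub y (n - k)
    unfold backInc particleStep at *
    rw [Finset.sum_range_succ]
    push_cast
    rw [show n - ((k : ℤ) + 1) = n - k - 1 by ring]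
    linarith

theorem BddPast.isLUB_pathEncoding {y : Config} (hy : BddPast y) (n : ℤ) :
    IsLUB (pathEncoding y '' Set.Iic n) (pathEncoding y n + carrier y n) := by
  have h := hy.isLUB_carrier n
  constructor
  · rintro _ ⟨m, hm, rfl⟩
    obtain ⟨k, hk⟩ := Int.eq_ofNat_of_zero_le (sub_nonneg.2 (Set.mem_Iic.1 hm))
    have h1 := h.1 ⟨k, rfl⟩
    rw [show m = n - k by omega, pathEncoding_sub_natCast]
    linarith
  · intro b hb
    have : (carrier y n : ℤ) ≤ b - pathEncoding y n := by
      refine h.2 ?_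
      rintro _ ⟨k, rfl⟩
      have h1 := hb ⟨n - k, by simp, rfl⟩
      rw [pathEncoding_sub_natCast] at h1
      linarith
    linarith

theorem BddPast.pastMax_eq {y : Config} (hy : BddPast y) (n : ℤ) :
    pastMax (pathEncoding y) n = pathEncoding y n + carrier y n :=
  (hy.isLUB_pathEncoding n).csSup_eq ⟨_, n, Set.mem_Iic.2 le_rfl, rfl⟩

/-- Up to a constant, TS = S + 2W. A particle changes (S, W) by (-1, +1), and a hole by (+1, -1), or
by (+1, 0) when the carrier is empty; so TS steps down exactly when the load drops. -/
theorem BddPast.pitman_eq {y : Config} (hy : BddPast y) :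
    pitman (pathEncoding y) = pathEncoding (bbs y) := by
  refine pathEncoding_unique (by simp [pitman, pathEncoding_zero]) fun n => ?_
  have h := hy.carrier_succ (n - 1)
  have h1 := pathEncoding_sub y n
  rw [sub_add_cancel] at h
  unfold loadStep at h
  simp only [pitman, hy.pastMax_eq, bbs]
  rcases Fin.exists_fin_two.1 ⟨y n, rfl⟩ with h' | h' <;> rw [h'] at h h1 <;> simp at h h1 <;>
    split_ifs <;> simp <;> omega

theorem mem_localMaxima_iff (y : Config) (n : ℤ) :
    n ∈ localMaxima (pathEncoding y) ↔ y n = 0 ∧ y (n + 1) = 1 := by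
  have h0 := pathEncoding_sub y n
  have h1 := pathEncoding_sub y (n + 1)
  rw [add_sub_cancel_right] at h1
  simp only [localMaxima, Set.mem_ofPred_eq, Fin.ext_iff, Fin.val_zero, Fin.val_one]
  have := (y n).isLt
  have := (y (n + 1)).isLt
  omega

/-- A drop of the load at `n + 1` means a hole there and a positive load at `n`; a positive load
that did not just drop has just risen, so there was a particle at `n`. -/
theorem BddPast.bbs_localMax_iff {y : Config} (hy : BddPast y) (n : ℤ) :
    bbs y n = 0 ∧ bbs y (n + 1) = 1 ↔ y n = 1 ∧ y (n + 1) = 0 := by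
  have h0 := hy.carrier_succ (n - 1)
  have h1 := hy.carrier_succ n
  rw [sub_add_cancel] at h0
  unfold loadStep at h0 h1
  simp only [bbs, add_sub_cancel_right]
  rcases Fin.exists_fin_two.1 ⟨y n, rfl⟩ with h' | h' <;>
  rcases Fin.exists_fin_two.1 ⟨y (n + 1), rfl⟩ with h'' | h'' <;>
    simp [h', h''] at h0 h1 ⊢ <;> omega

/-! ### Runs of particles after a local maximum and before a local minimum. -/

/-- The configurations with a local maximum at `0` whose next local minimum is at `k + 1`. -/
def runAfter (k : ℕ) : Set Config :=
  {y | y 0 = 0 ∧ (∀ i ∈ Set.Icc (1 : ℤ) (k + 1), y i = 1) ∧ y (k + 2) = 0}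

/-- The configurations with a local minimum at `0` whose previous local maximum is at
`-(k + 1)`. -/
def runBefore (k : ℕ) : Set Config := {y | seqShift (-(k + 1)) y ∈ runAfter k}

theorem firstLocalMax_pitman {y : Config} (hy : BddPast y) {k : ℕ} (hk : y ∈ runAfter k) :
    IsLeast {n : ℤ | 0 ≤ n ∧ n ∈ localMaxima (pitman (pathEncoding y))} (k + 1) := by
  obtain ⟨h0, h1, h2⟩ := hk
  simp only [hy.pitman_eq, mem_localMaxima_iff, hy.bbs_localMax_iff]
  refine ⟨⟨by omega, h1 _ ⟨by omega, le_rfl⟩, by rw [add_assoc]; exact h2⟩, ?_⟩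
  rintro n ⟨hn, hn1, hn2⟩
  by_contra! hlt
  by_cases hn0 : n = 0
  · rw [hn0, h0] at hn1
    exact absurd hn1 (by decide)
  · rw [h1 (n + 1) ⟨by omega, by omega⟩] at hn2
    exact absurd hn2 (by decide)

/-- On a fixed run length the random shift is deterministic and commutes with the dynamics, so it
can be applied first. -/
theorem palmStep_pathEncoding {y : Config} (hy : BddPast y) {k : ℕ} (hk : y ∈ runAfter k) :
    palmStep (pathEncoding y) = pathEncoding (bbs (seqShift (k + 1) y)) := by
  rw [palmStep, firstLocalMax, (firstLocalMax_pitman hy hk).csInf_eq, hy.pitman_eq,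
    pathShift_pathEncoding, bbs_seqShift]

theorem runBefore_subset (k : ℕ) : runBefore k ⊆ {y | y 0 = 1 ∧ y 1 = 0} := by
  rintro y ⟨-, h1, h2⟩
  have := h1 (k + 1) ⟨by omega, le_rfl⟩
  simp only [seqShift, add_neg_cancel] at this
  simp only [seqShift] at h2
  exact ⟨this, by rw [← h2]; congr 1; ring⟩

theorem runAfter_subset (k : ℕ) : runAfter k ⊆ {y | y 0 = 0 ∧ y 1 = 1} := by
  rintro y ⟨h0, h1, -⟩
  exact ⟨h0, h1 1 ⟨le_rfl, by omega⟩⟩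

theorem pairwise_disjoint_runAfter : Pairwise (Function.onFun Disjoint runAfter) := by
  have key : ∀ i j, i < j → Disjoint (runAfter i) (runAfter j) := by
    intro i j hij
    rw [Set.disjoint_left]
    rintro y ⟨-, -, h2⟩ ⟨-, h1, -⟩
    rw [h1 _ ⟨by omega, by omega⟩] at h2
    exact absurd h2 (by decide)
  intro i j hij
  rcases lt_or_gt_of_ne hij with h | h
  · exact key i j h
  · exact (key j i h).symm

theorem pairwise_disjoint_runBefore : Pairwise (Function.onFun Disjoint runBefore) := by
  have key : ∀ i j, i < j → Disjoint (runBefore i) (runBefore j) := by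
    intro i j hij
    rw [Set.disjoint_left]
    rintro y ⟨h0, -, -⟩ ⟨-, h1, -⟩
    have := h1 (j - i) ⟨by omega, by omega⟩
    simp only [seqShift] at h0 this
    rw [show (j : ℤ) - i + -(j + 1) = 0 + -(i + 1) by ring, h0] at this
    exact absurd this (by decide)
  intro i j hij
  rcases lt_or_gt_of_ne hij with h | h
  · exact key i j h
  · exact (key j i h).symm

theorem BddPast.exists_runBefore {y : Config} (hy : BddPast y) (h0 : y 0 = 1) (h1 : y 1 = 0) :
    ∃ k, y ∈ runBefore k := by
  -- With particles at every site to the left, the backward increments would grow linearly,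
  -- contradicting the bounded past.
  have hex : ∃ k : ℕ, y (-(k + 1)) = 0 := by
    by_contra! hne
    have h1 : ∀ k : ℕ, y (0 - k) = 1 := by
      intro k
      rcases k with _ | k
      · simpa using h0
      · have := hne k
        rw [show (0 : ℤ) - (k + 1 : ℕ) = -(k + 1) by push_cast; ring]
        omega
    obtain ⟨b, hb⟩ := hy 0
    have := hb ⟨b.toNat + 1, rfl⟩
    simp only [backInc, h1, particleStep, Fin.val_one, Finset.sum_const, Finset.card_range] at this
    simp at this
  obtain ⟨k, hk, hmin⟩ : ∃ k : ℕ, y (-(k + 1)) = 0 ∧ ∀ j < k, y (-((j : ℤ) + 1)) ≠ 0 := by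
    classical
    exact ⟨Nat.find hex, Nat.find_spec hex, fun j hj => Nat.find_min hex hj⟩
  refine ⟨k, ?_⟩
  simp only [runBefore, runAfter, Set.mem_ofPred_eq, seqShift, zero_add]
  refine ⟨hk, ?_, ?_⟩
  · rintro i ⟨hi1, hi2⟩
    by_cases hi : i = k + 1
    · rwa [hi, add_neg_cancel]
    · have := hmin ((k : ℤ) - i).toNat (by omega)
      rw [show i + -((k : ℤ) + 1) = -((((k : ℤ) - i).toNat : ℤ) + 1) by omega]
      omega
  · rw [← h1]
    congr 1
    ring

/-! ### Laws of two-sided sequences, cylinders and reversibility. -/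

theorem measurable_seqShift {α : Type*} [MeasurableSpace α] (m : ℤ) :
    Measurable (seqShift m : (ℤ → α) → ℤ → α) :=
  measurable_pi_lambda _ fun n => measurable_pi_apply (n + m)

theorem measurable_seqRev {α : Type*} [MeasurableSpace α] :
    Measurable (seqRev : (ℤ → α) → ℤ → α) :=
  measurable_pi_lambda _ fun n => measurable_pi_apply (-n)

/-- Finite measures on a space of sequences with countably many values agree if they agree on a
cofinal family of cylinders. -/
theorem measure_ext_of_cylinders {ι α : Type*} [Countable α] [Nonempty α] [MeasurableSpace α]
    [MeasurableSingletonClass α] {μ ν : Measure (ι → α)} [IsFiniteMeasure μ] [IsFiniteMeasure ν]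
    (s : ℕ → Finset ι) (hs : ∀ I : Finset ι, ∃ k, I ⊆ s k)
    (h : ∀ k (x : ι → α), μ {y | ∀ i ∈ s k, y i = x i} = ν {y | ∀ i ∈ s k, y i = x i}) :
    μ = ν := by
  have key : ∀ k, μ.map (s k).restrict = ν.map (s k).restrict := by
    intro k
    refine Measure.ext_of_singleton fun a => ?_
    classical
    have hpre : ((s k).restrict : (ι → α) → (s k → α)) ⁻¹' {a} = {y : ι → α | ∀ i ∈ s k,
        y i = (fun i => if hi : i ∈ s k then a ⟨i, hi⟩ else Classical.arbitrary α) i} := by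
      ext y
      simp only [Set.mem_preimage, Set.mem_singleton_iff, Set.mem_ofPred_eq, funext_iff,
        Subtype.forall, Finset.restrict]
      refine forall₂_congr fun i hi => ?_
      rw [dif_pos hi]
    have hm : Measurable ((s k).restrict : (ι → α) → (s k → α)) := Finset.measurable_restrict _
    rw [Measure.map_apply hm (measurableSet_singleton a),
      Measure.map_apply hm (measurableSet_singleton a), hpre]
    exact h k _
  -- Any finite marginal is a marginal of some window `s k`, so both measures are projective limits
  -- of one family.
  have hlim : IsProjectiveLimit ν (fun I : Finset ι => μ.map I.restrict) := by
    intro I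
    obtain ⟨k, hk⟩ := hs I
    have hc : (I.restrict : (ι → α) → (I → α)) =
        Finset.restrict₂ (π := fun _ => α) hk ∘ (s k).restrict := rfl
    simp only [hc]
    rw [← Measure.map_map (Finset.measurable_restrict₂ _) (Finset.measurable_restrict _),
      ← Measure.map_map (Finset.measurable_restrict₂ _) (Finset.measurable_restrict _), key]
  exact IsProjectiveLimit.unique (P := fun I : Finset ι => μ.map I.restrict) (fun _ => rfl) hlim

/-- The sequences with prescribed values at the sites `0, …, n`. -/
def initCyl {α : Type*} (n : ℕ) (u : ℕ → α) : Set (ℤ → α) := {z | ∀ i : ℕ, i ≤ n → z i = u i}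

theorem initCyl_succ {α : Type*} (n : ℕ) (u : ℕ → α) :
    initCyl (n + 1) u = initCyl n u ∩ {z | z (n + 1) = u (n + 1)} := by
  ext z
  constructor
  · intro h
    exact ⟨fun i hi => h i (by omega), by have := h (n + 1) le_rfl; push_cast at this; exact this⟩
  · rintro ⟨h1, h2⟩ i hi
    rcases Nat.lt_or_eq_of_le hi with hi | rfl
    · exact h1 i (by omega)
    · push_cast
      exact h2

theorem initCyl_zero {α : Type*} (u : ℕ → α) : initCyl 0 u = {z | z 0 = u 0} := by
  ext z
  simp [initCyl]

theorem initCyl_one {α : Type*} (u : ℕ → α) :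
    initCyl 1 u = {z : ℤ → α | z 0 = u 0 ∧ z 1 = u 1} := by
  rw [initCyl_succ, initCyl_zero]
  ext z
  simp

theorem measurableSet_initCyl {α : Type*} [MeasurableSpace α] [MeasurableSingletonClass α] (n : ℕ)
    (u : ℕ → α) : MeasurableSet (initCyl n u) := by
  have : initCyl n u = ⋂ i : ℕ, ⋂ _ : i ≤ n, {z : ℤ → α | z i = u i} := by
    ext z; simp [initCyl]
  rw [this]
  exact MeasurableSet.iInter fun i => MeasurableSet.iInter fun _ =>
    measurable_pi_apply _ (measurableSet_singleton _)

/-- A stationary second-order Markov chain satisfying detailed balance for its pairs of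
consecutive states is reversible. -/
theorem map_seqRev_of_detailedBalance {α : Type*} [Countable α] [Nonempty α] [MeasurableSpace α]
    [MeasurableSingletonClass α] {Λ : Measure (ℤ → α)} [IsFiniteMeasure Λ]
    (hshift : ∀ m, Λ.map (seqShift m) = Λ) (Q : α → α → α → ℝ≥0∞)
    (hQ : ∀ (n : ℕ) (u : ℕ → α),
      Λ (initCyl (n + 2) u) = Λ (initCyl (n + 1) u) * Q (u n) (u (n + 1)) (u (n + 2)))
    (hsymm : ∀ a b, Λ {z | z 0 = a ∧ z 1 = b} = Λ {z | z 0 = b ∧ z 1 = a})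
    (hbal : ∀ a b c, Λ {z | z 0 = a ∧ z 1 = b} * Q a b c = Λ {z | z 0 = c ∧ z 1 = b} * Q c b a) :
    Λ.map seqRev = Λ := by
  have hprod : ∀ (n : ℕ) (u : ℕ → α), Λ (initCyl (n + 1) u) = Λ {z | z 0 = u 0 ∧ z 1 = u 1} *
      ∏ k ∈ Finset.range n, Q (u k) (u (k + 1)) (u (k + 2)) := by
    intro n u
    induction n with
    | zero => simp [initCyl_one]
    | succ n ih => rw [hQ, ih, Finset.prod_range_succ, mul_assoc]
  -- Detailed balance carries the pair mass through the product one weight at a time, reversing each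
  -- weight it passes.
  have hswap : ∀ (n : ℕ) (u : ℕ → α), Λ {z | z 0 = u 0 ∧ z 1 = u 1} *
      ∏ k ∈ Finset.range n, Q (u k) (u (k + 1)) (u (k + 2)) =
      Λ {z | z 0 = u (n + 1) ∧ z 1 = u n} *
      ∏ k ∈ Finset.range n, Q (u (k + 2)) (u (k + 1)) (u k) := by
    intro n u
    induction n with
    | zero => simpa using hsymm _ _
    | succ n ih =>
      rw [Finset.prod_range_succ, ← mul_assoc, ih, Finset.prod_range_succ, mul_right_comm,
        hsymm (u (n + 1)), hbal]
      ring
  have hrev : ∀ (n : ℕ) (u : ℕ → α),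
      Λ (initCyl (n + 1) u) = Λ (initCyl (n + 1) fun i => u (n + 1 - i)) := by
    intro n u
    rw [hprod, hswap, hprod]
    congr 1
    rw [← Finset.prod_range_reflect]
    refine Finset.prod_congr rfl fun k hk => ?_
    have := Finset.mem_range.1 hk
    congr 2 <;> omega
  -- Symmetric windows are stable under reflection; stationarity moves them to start at 0.
  have hwin : ∀ (k : ℕ) (x : ℤ → α), Λ {y | ∀ i ∈ Finset.Icc (-(k + 1) : ℤ) (k + 1), y i = x i} =
      Λ (initCyl (2 * k + 1 + 1) fun j => x (j - (k + 1))) := by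
    intro k x
    conv_rhs => rw [← hshift (-(k + 1))]
    rw [Measure.map_apply (measurable_seqShift _) (measurableSet_initCyl _ _)]
    congr 1
    ext y
    constructor
    · intro h i hi
      exact h _ (Finset.mem_Icc.2 ⟨by omega, by omega⟩)
    · intro h i hi
      have hi := Finset.mem_Icc.1 hi
      have := h (i + (k + 1)).toNat (by omega)
      simp only [seqShift] at this
      rwa [show (((i + (k + 1)).toNat : ℕ) : ℤ) + -((k : ℤ) + 1) = i by omega,
        show (((i + (k + 1)).toNat : ℕ) : ℤ) - ((k : ℤ) + 1) = i by omega] at this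
  have : IsFiniteMeasure (Λ.map seqRev) := inferInstance
  refine measure_ext_of_cylinders (fun k => Finset.Icc (-(k + 1) : ℤ) (k + 1)) ?_ ?_
  · intro I
    refine ⟨∑ i ∈ I, i.natAbs, fun i hi => ?_⟩
    have := Finset.single_le_sum (f := Int.natAbs) (fun _ _ => Nat.zero_le _) hi
    exact Finset.mem_Icc.2 ⟨by omega, by omega⟩
  · intro k x
    have hm : MeasurableSet {y : ℤ → α | ∀ i ∈ Finset.Icc (-(k + 1) : ℤ) (k + 1), y i = x i} := by
      have : {y : ℤ → α | ∀ i ∈ Finset.Icc (-(k + 1) : ℤ) (k + 1), y i = x i} =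
          ⋂ i ∈ Finset.Icc (-(k + 1) : ℤ) (k + 1), {y | y i = x i} := by ext y; simp
      rw [this]
      exact Finset.measurableSet_biInter _ fun i _ =>
        measurableSet_eq_fun (measurable_pi_apply _) measurable_const
    rw [Measure.map_apply measurable_seqRev hm]
    have hpre : seqRev ⁻¹' {y : ℤ → α | ∀ i ∈ Finset.Icc (-(k + 1) : ℤ) (k + 1), y i = x i} =
        {y | ∀ i ∈ Finset.Icc (-(k + 1) : ℤ) (k + 1), y i = x (-i)} := by
      ext y
      simp only [Set.mem_preimage, Set.mem_ofPred_eq, Finset.mem_Icc, seqRev]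
      constructor <;> intro h i hi
      · have := h (-i) ⟨by omega, by omega⟩
        rwa [neg_neg] at this
      · rw [h (-i) ⟨by omega, by omega⟩, neg_neg]
    rw [hpre, hwin, hwin, hrev]
    congr 1
    ext z
    refine forall₂_congr fun i hi => ?_
    dsimp only
    rw [show -(((2 * k + 1 + 1 - i : ℕ) : ℤ) - (k + 1)) = (i : ℤ) - (k + 1) by omega]

/-! ### The Markov property relative to the whole past. -/

/-- The transition probabilities of the chain. -/
noncomputable def transProb (p₀ p₁ : ℝ) (i j : Fin 2) : ℝ≥0∞ :=
  ENNReal.ofReal (transMatrix p₀ p₁ i j)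

theorem transProb_add (p₀ p₁ : ℝ) (hp₀ : p₀ ∈ Set.Ioo (0 : ℝ) 1) (hp₁ : p₁ ∈ Set.Ioo (0 : ℝ) 1)
    (i : Fin 2) : transProb p₀ p₁ i 0 + transProb p₀ p₁ i 1 = 1 := by
  obtain ⟨h1, h2⟩ := hp₀
  obtain ⟨h3, h4⟩ := hp₁
  unfold transProb
  rcases Fin.exists_fin_two.1 ⟨i, rfl⟩ with h | h <;> rw [h, ← ENNReal.ofReal_add] <;>
    simp [transMatrix] <;> linarith

/-- The configuration frozen after the site `n`. -/
def clip (n : ℤ) (y : Config) (m : ℤ) : Fin 2 := y (min m n)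

theorem measurable_clip (n : ℤ) : Measurable (clip n) :=
  measurable_pi_lambda _ fun m => measurable_pi_apply (min m n)

theorem clip_apply_of_le {n m : ℤ} (h : m ≤ n) (y : Config) : clip n y m = y m := by
  rw [clip, min_eq_left h]

theorem measurableSet_site (n : ℤ) (i : Fin 2) : MeasurableSet {y : Config | y n = i} :=
  measurableSet_eq_fun (measurable_pi_apply _) measurable_const

/-- The laws of stationary Markov chains with given transition probabilities. -/
structure IsStationaryMarkovLaw (L : Measure Config) (p₀ p₁ : ℝ) : Prop where
  prob : IsProbabilityMeasure L
  shift : ∀ m, L.map (seqShift m) = L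
  markov : ∀ n i j, (L.restrict ({y | y n = i} ∩ {y | y (n + 1) = j})).map (clip n) =
    transProb p₀ p₁ i j • (L.restrict {y | y n = i}).map (clip n)

theorem IsStationaryMarkov.law {Ω : Type*} [MeasurableSpace Ω] {μ : Measure Ω}
    [IsProbabilityMeasure μ] {p₀ p₁ : ℝ} {η : Ω → Config}
    (hη : IsStationaryMarkov μ (transMatrix p₀ p₁) η) :
    IsStationaryMarkovLaw (μ.map η) p₀ p₁ := by
  have hprob := Measure.isProbabilityMeasure_map hη.measurable.aemeasurable (μ := μ)
  refine ⟨hprob, fun m => ?_, fun n i j => ?_⟩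
  · rw [Measure.map_map (measurable_seqShift m) hη.measurable]
    exact hη.stationary m
  have hcyl : ∀ (k : ℕ) (x : Config), x n = i →
      μ.map η ({y | ∀ m ∈ Set.Icc (n - k) n, y m = x m} ∩ {y | y (n + 1) = j}) =
        transProb p₀ p₁ i j * μ.map η {y | ∀ m ∈ Set.Icc (n - k) n, y m = x m} := by
    intro k x hx
    have hZ : MeasurableSet {y : Config | ∀ m ∈ Set.Icc (n - k) n, y m = x m} := by
      have : {y : Config | ∀ m ∈ Set.Icc (n - k) n, y m = x m} =
          ⋂ m, ⋂ _ : m ∈ Set.Icc (n - k) n, {y | y m = x m} := by ext y; simp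
      rw [this]
      exact MeasurableSet.iInter fun m => MeasurableSet.iInter fun _ => measurableSet_site _ _
    rw [Measure.map_apply hη.measurable (hZ.inter (measurableSet_site _ _)),
      Measure.map_apply hη.measurable hZ]
    by_cases h0 : μ (η ⁻¹' {y | ∀ m ∈ Set.Icc (n - k) n, y m = x m}) = 0
    · rw [h0, mul_zero]
      exact measure_mono_null (Set.preimage_mono Set.inter_subset_left) h0
    · have h1 := hη.markov n k x j h0
      rw [hx] at h1
      rw [transProb, ← h1]
      exact (cond_mul_eq_inter (hη.measurable hZ) _ _).symm
  have : IsFiniteMeasure (transProb p₀ p₁ i j •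
      ((μ.map η).restrict {y | y n = i}).map (clip n)) :=
    Measure.smul_finite _ ENNReal.ofReal_ne_top
  refine measure_ext_of_cylinders (fun k => Finset.Icc (n - k) (n + k)) ?_ ?_
  · intro I
    refine ⟨∑ i ∈ I, (i - n).natAbs, fun i hi => ?_⟩
    have := Finset.single_le_sum (f := fun i => (i - n).natAbs) (fun _ _ => Nat.zero_le _) hi
    exact Finset.mem_Icc.2 ⟨by omega, by omega⟩
  · intro k x
    have hZ : MeasurableSet {y : Config | ∀ m ∈ Finset.Icc (n - k) (n + k), y m = x m} := by
      have : {y : Config | ∀ m ∈ Finset.Icc (n - k) (n + k), y m = x m} =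
          ⋂ m ∈ Finset.Icc (n - k) (n + k), {y | y m = x m} := by ext y; simp
      rw [this]
      exact Finset.measurableSet_biInter _ fun m _ => measurableSet_site _ _
    rw [Measure.smul_apply, smul_eq_mul, Measure.map_apply (measurable_clip n) hZ,
      Measure.map_apply (measurable_clip n) hZ, Measure.restrict_apply (measurable_clip n hZ),
      Measure.restrict_apply (measurable_clip n hZ), ← Set.inter_assoc]
    -- A clipped configuration is constant from `n` on, so any other pattern gives an empty
    -- preimage.
    by_cases hx : x n = i ∧ ∀ m ∈ Finset.Icc n (n + k), x m = x n
    · have hset : clip n ⁻¹' {y | ∀ m ∈ Finset.Icc (n - k) (n + k), y m = x m} ∩ {y | y n = i} =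
          {y | ∀ m ∈ Set.Icc (n - k) n, y m = x m} := by
        ext y
        constructor
        · rintro ⟨h1, -⟩ m ⟨hm1, hm2⟩
          have := h1 m (Finset.mem_Icc.2 ⟨hm1, by omega⟩)
          rwa [clip_apply_of_le hm2] at this
        · intro h
          refine ⟨fun m hm => ?_, (h n ⟨by omega, le_rfl⟩).trans hx.1⟩
          have hm := Finset.mem_Icc.1 hm
          rcases le_total m n with hmn | hmn
          · rw [clip_apply_of_le hmn]
            exact h m ⟨hm.1, hmn⟩
          · rw [clip, min_eq_right hmn, hx.2 m (Finset.mem_Icc.2 ⟨hmn, hm.2⟩)]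
            exact h n ⟨by omega, le_rfl⟩
      rw [hset]
      exact hcyl k x hx.1
    · have hset : clip n ⁻¹' {y | ∀ m ∈ Finset.Icc (n - k) (n + k), y m = x m} ∩ {y | y n = i} =
          ∅ := by
        rw [Set.eq_empty_iff_forall_notMem]
        rintro y ⟨h1, h2⟩
        have hn := h1 n (Finset.mem_Icc.2 ⟨by omega, by omega⟩)
        rw [clip_apply_of_le le_rfl] at hn
        refine hx ⟨hn ▸ h2, fun m hm => ?_⟩
        have hm := Finset.mem_Icc.1 hm
        have hm' := h1 m (Finset.mem_Icc.2 ⟨by omega, hm.2⟩)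
        rw [clip, min_eq_right hm.1] at hm'
        rw [← hm', hn]
      rw [hset]
      simp

variable {L : Measure Config} {p₀ p₁ : ℝ}

/-- The Markov property for events that depend on the sites up to `n` only. -/
theorem IsStationaryMarkovLaw.measure_inter (hL : IsStationaryMarkovLaw L p₀ p₁) (n : ℤ)
    (i j : Fin 2) {A : Set Config} (hA : MeasurableSet A)
    (hpast : ∀ y z : Config, (∀ m ≤ n, y m = z m) → y ∈ A → z ∈ A) :
    L (A ∩ ({y | y n = i} ∩ {y | y (n + 1) = j})) =
      transProb p₀ p₁ i j * L (A ∩ {y | y n = i}) := by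
  have hpre : clip n ⁻¹' A = A := by
    ext y
    exact ⟨hpast _ _ fun m hm => clip_apply_of_le hm y,
      hpast _ _ fun m hm => (clip_apply_of_le hm y).symm⟩
  have h := congrArg (fun ν => ν A) (hL.markov n i j)
  simp only [Measure.smul_apply, smul_eq_mul] at h
  rwa [Measure.map_apply (measurable_clip n) hA, Measure.map_apply (measurable_clip n) hA, hpre,
    Measure.restrict_apply hA, Measure.restrict_apply hA] at h

/-- The Markov property for functions that depend on the sites up to `n` only. -/
theorem IsStationaryMarkovLaw.lintegral_inter (hL : IsStationaryMarkovLaw L p₀ p₁) (n : ℤ)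
    (i j : Fin 2) {f : Config → ℝ≥0∞} (hf : Measurable f)
    (hpast : ∀ y z : Config, (∀ m ≤ n, y m = z m) → f y = f z) :
    ∫⁻ y in {y | y n = i} ∩ {y | y (n + 1) = j}, f y ∂L =
      transProb p₀ p₁ i j * ∫⁻ y in {y | y n = i}, f y ∂L := by
  have hpre : ∀ y, f (clip n y) = f y := fun y => hpast _ _ fun m hm => clip_apply_of_le hm y
  have h := congrArg (fun ν => ∫⁻ y, f y ∂ν) (hL.markov n i j)
  simp only [lintegral_smul_measure, smul_eq_mul] at h
  rw [lintegral_map hf (measurable_clip n), lintegral_map hf (measurable_clip n)] at h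
  simpa only [hpre] using h

/-! ### Measurability, and almost sure boundedness of the past. -/

theorem measurable_backInc (n : ℤ) (k : ℕ) : Measurable fun y => backInc y n k :=
  Finset.measurable_fun_sum _ fun _ _ =>
    (Measurable.of_discrete (f := particleStep)).comp (measurable_pi_apply _)

theorem measurable_carrier : Measurable carrier :=
  measurable_pi_lambda _ fun n => (Measurable.of_discrete (f := Int.toNat)).comp
    (Measurable.iSup fun k => measurable_backInc n k)

theorem measurable_bbs : Measurable bbs := by
  refine measurable_pi_lambda _ fun n => ?_
  have h : ∀ n, Measurable fun y => carrier y n := fun n =>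
    (measurable_pi_apply n).comp measurable_carrier
  exact Measurable.ite (measurableSet_lt (h n) (h (n - 1))) measurable_const measurable_const

theorem restrict_eq_add_site (L : Measure Config) (s : Set Config) (n : ℤ) :
    L.restrict s = L.restrict ({y | y n = 0} ∩ s) + L.restrict ({y | y n = 1} ∩ s) := by
  have h := Measure.restrict_inter_add_sdiff (μ := L) s (measurableSet_site n 0)
  rw [← h, Set.inter_comm s]
  congr 2
  ext y
  simp only [Set.mem_sdiff, Set.mem_inter_iff, Set.mem_ofPred_eq]
  constructor
  · rintro ⟨h1, h2⟩
    exact ⟨by omega, h1⟩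
  · rintro ⟨h1, h2⟩
    exact ⟨h2, by omega⟩

/-- A positive test vector contracted by the exponentially tilted transition matrix. -/
theorem exists_tilted_contraction (hp₀ : p₀ ∈ Set.Ioo (0 : ℝ) 1) (hp₁ : p₁ ∈ Set.Ioo (0 : ℝ) 1)
    (hp : p₀ + p₁ < 1) : ∃ (x r h₀ h₁ : ℝ), 1 < x ∧ 0 ≤ r ∧ r < 1 ∧ 1 ≤ h₀ ∧ 1 ≤ h₁ ∧
      (1 - p₀) * x⁻¹ * h₀ + p₀ * x * h₁ ≤ r * h₀ ∧
      (1 - p₁) * x⁻¹ * h₀ + p₁ * x * h₁ ≤ r * h₁ := by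
  obtain ⟨hp₀, hp₀'⟩ := hp₀
  obtain ⟨hp₁, hp₁'⟩ := hp₁
  -- With p₁ = a² and 1 - p₀ = b², the tilt x = b / a makes both diagonal entries equal to ab. The
  -- Perron eigenvalue is below 1 iff (1 - a²)(1 - b²) < (1 - ab)², that is, iff (b - a)² > 0.
  obtain ⟨a, ha, rfl⟩ : ∃ a : ℝ, 0 < a ∧ p₁ = a ^ 2 :=
    ⟨√p₁, Real.sqrt_pos.2 hp₁, (Real.sq_sqrt hp₁.le).symm⟩
  obtain ⟨b, hb, hb'⟩ : ∃ b : ℝ, 0 < b ∧ 1 - p₀ = b ^ 2 :=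
    ⟨√(1 - p₀), Real.sqrt_pos.2 (by linarith), (Real.sq_sqrt (by linarith)).symm⟩
  obtain rfl : p₀ = 1 - b ^ 2 := by linarith
  have hab : a < b := lt_of_pow_lt_pow_left₀ 2 hb.le (by linarith)
  have hb1 : b < 1 := by nlinarith
  have hs : a * b < 1 := by nlinarith
  have hx0 : 0 < b / a := div_pos hb ha
  -- For the test vector (c, 1 - ab), the lower bound on c is the first row inequality and the upper
  -- bound the second.
  obtain ⟨c, hc1, hc2⟩ : ∃ c, b / a * (1 - b ^ 2) < c ∧ c < (1 - a * b) ^ 2 * (b / a) / (1 - a ^ 2) := by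
    refine exists_between ?_
    rw [lt_div_iff₀ (by linarith), mul_assoc, mul_comm]
    refine mul_lt_mul_of_pos_right ?_ hx0
    nlinarith [sq_pos_of_pos (sub_pos.2 hab)]
  have hc0 : 0 < c := lt_trans (mul_pos hx0 hp₀) hc1
  have hc3 : c * (1 - a ^ 2) * (b / a)⁻¹ < (1 - a * b) ^ 2 := by
    rw [lt_div_iff₀ (by linarith)] at hc2
    rwa [← div_eq_mul_inv, div_lt_iff₀ hx0]
  have hs0 : 0 < 1 - a * b := by linarith
  -- Rescaling by t makes both entries at least 1.
  set t := 1 / c + 1 / (1 - a * b) with ht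
  have ht0 : 0 < t := by positivity
  have e1 : b ^ 2 * (b / a)⁻¹ = a * b := by field_simp
  have e2 : a ^ 2 * (b / a) = a * b := by field_simp
  have k0 : (1 - (1 - b ^ 2)) * (b / a)⁻¹ * (c * t) + (1 - b ^ 2) * (b / a) * ((1 - a * b) * t)
      < c * t := by
    have : (1 - b ^ 2) * (b / a) * (1 - a * b) < c * (1 - a * b) :=
      mul_lt_mul_of_pos_right (by linarith) hs0
    calc _ = (b ^ 2 * (b / a)⁻¹ * c + (1 - b ^ 2) * (b / a) * (1 - a * b)) * t := by ring
      _ < (a * b * c + c * (1 - a * b)) * t := by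
        rw [e1]
        exact mul_lt_mul_of_pos_right (by linarith) ht0
      _ = c * t := by ring
  have k1 : (1 - a ^ 2) * (b / a)⁻¹ * (c * t) + a ^ 2 * (b / a) * ((1 - a * b) * t)
      < (1 - a * b) * t := by
    calc _ = (c * (1 - a ^ 2) * (b / a)⁻¹ + a ^ 2 * (b / a) * (1 - a * b)) * t := by ring
      _ < ((1 - a * b) ^ 2 + a * b * (1 - a * b)) * t := by
        rw [e2]
        exact mul_lt_mul_of_pos_right (by linarith) ht0
      _ = (1 - a * b) * t := by ring
  have hct : 0 < c * t := mul_pos hc0 ht0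
  have hst : 0 < (1 - a * b) * t := mul_pos hs0 ht0
  refine ⟨b / a, max (((1 - (1 - b ^ 2)) * (b / a)⁻¹ * (c * t) +
      (1 - b ^ 2) * (b / a) * ((1 - a * b) * t)) / (c * t))
      (((1 - a ^ 2) * (b / a)⁻¹ * (c * t) + a ^ 2 * (b / a) * ((1 - a * b) * t)) /
        ((1 - a * b) * t)), c * t, (1 - a * b) * t, ?_, ?_, ?_, ?_, ?_, ?_, ?_⟩
  · rwa [one_lt_div ha]
  · refine le_max_of_le_left (div_nonneg ?_ hct.le)
    have : 0 < (b / a)⁻¹ := inv_pos.2 hx0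
    have : 0 ≤ 1 - (1 - b ^ 2) := by linarith
    positivity
  · exact max_lt ((div_lt_one hct).2 k0) ((div_lt_one hst).2 k1)
  · have : c * (1 / c) = 1 := by field_simp
    have : 0 < c * (1 / (1 - a * b)) := by positivity
    rw [ht, mul_add]
    linarith
  · have : (1 - a * b) * (1 / (1 - a * b)) = 1 := by field_simp
    have : 0 < (1 - a * b) * (1 / c) := by positivity
    rw [ht, mul_add]
    linarith
  · rw [← div_le_iff₀ hct]
    exact le_max_left _ _
  · rw [← div_le_iff₀ hst]
    exact le_max_right _ _

/-- The tilted moments of the backward increment, split by the last site, are contracted at each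
step. Hence the probability that the increment over `k` sites is nonnegative decays geometrically in
`k`, and Borel–Cantelli makes it eventually negative. -/
theorem IsStationaryMarkovLaw.ae_bddPast (hL : IsStationaryMarkovLaw L p₀ p₁)
    (hp₀ : p₀ ∈ Set.Ioo (0 : ℝ) 1) (hp₁ : p₁ ∈ Set.Ioo (0 : ℝ) 1) (hp : p₀ + p₁ < 1) :
    ∀ᵐ y ∂L, BddPast y := by
  have := hL.prob
  obtain ⟨x, r, h₀, h₁, hx, hr0, hr1, hh0, hh1, hc0, hc1⟩ := exists_tilted_contraction hp₀ hp₁ hp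
  obtain ⟨hp₀, hp₀'⟩ := hp₀
  obtain ⟨hp₁, hp₁'⟩ := hp₁
  have hx0 : 0 < x := by linarith
  set f : ℤ → ℕ → Config → ℝ≥0∞ := fun n k y => ENNReal.ofReal (x ^ backInc y n k) with hf
  have hfm : ∀ n k, Measurable (f n k) := fun n k =>
    (Measurable.of_discrete (f := fun m : ℤ => ENNReal.ofReal (x ^ m))).comp
      (measurable_backInc n k)
  set I : ℤ → ℕ → Fin 2 → ℝ≥0∞ := fun n k j => ∫⁻ y in {y | y n = j}, f n k y ∂L with hI
  have hstep : ∀ n k j, I (n + 1) (k + 1) j = ENNReal.ofReal (x ^ particleStep j) *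
      (transProb p₀ p₁ 0 j * I n k 0 + transProb p₀ p₁ 1 j * I n k 1) := by
    intro n k j
    have h1 : I (n + 1) (k + 1) j =
        ∫⁻ y in {y | y (n + 1) = j}, ENNReal.ofReal (x ^ particleStep j) * f n k y ∂L := by
      refine setLIntegral_congr_fun (measurableSet_site _ _) fun y hy => ?_
      simp only [hf]
      rw [backInc_succ, zpow_add₀ hx0.ne', ENNReal.ofReal_mul (by positivity),
        show y (n + 1) = j from hy]
    rw [h1, lintegral_const_mul _ (hfm n k), restrict_eq_add_site L _ n, lintegral_add_measure]
    have hpast : ∀ y z : Config, (∀ m ≤ n, y m = z m) → f n k y = f n k z := fun y z h => by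
      simp only [hf, backInc_congr h]
    rw [hL.lintegral_inter n 0 j (hfm n k) hpast, hL.lintegral_inter n 1 j (hfm n k) hpast]
  have hcontr : ∀ n k, ENNReal.ofReal h₀ * I (n + 1) (k + 1) 0 +
      ENNReal.ofReal h₁ * I (n + 1) (k + 1) 1 ≤
      ENNReal.ofReal r * (ENNReal.ofReal h₀ * I n k 0 + ENNReal.ofReal h₁ * I n k 1) := by
    intro n k
    have hx1 : 0 ≤ x⁻¹ := by positivity
    have hc0' := ENNReal.ofReal_le_ofReal hc0
    have hc1' := ENNReal.ofReal_le_ofReal hc1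
    rw [ENNReal.ofReal_add (mul_nonneg (mul_nonneg (by linarith) hx1) (by linarith))
      (mul_nonneg (mul_nonneg (by linarith) hx0.le) (by linarith)),
      ENNReal.ofReal_mul (mul_nonneg (by linarith) hx1), ENNReal.ofReal_mul (by linarith),
      ENNReal.ofReal_mul (mul_nonneg (by linarith) hx0.le), ENNReal.ofReal_mul (by linarith),
      ENNReal.ofReal_mul hr0] at hc0' hc1'
    have e0 : x ^ particleStep 0 = x⁻¹ := by simp [particleStep]
    have e1 : x ^ particleStep 1 = x := by simp [particleStep]
    have t00 : transProb p₀ p₁ 0 0 = ENNReal.ofReal (1 - p₀) := by simp [transProb, transMatrix]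
    have t01 : transProb p₀ p₁ 0 1 = ENNReal.ofReal p₀ := by simp [transProb, transMatrix]
    have t10 : transProb p₀ p₁ 1 0 = ENNReal.ofReal (1 - p₁) := by simp [transProb, transMatrix]
    have t11 : transProb p₀ p₁ 1 1 = ENNReal.ofReal p₁ := by simp [transProb, transMatrix]
    rw [hstep, hstep, e0, e1, t00, t01, t10, t11]
    calc _ = (ENNReal.ofReal (1 - p₀) * ENNReal.ofReal x⁻¹ * ENNReal.ofReal h₀ +
          ENNReal.ofReal p₀ * ENNReal.ofReal x * ENNReal.ofReal h₁) * I n k 0 +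
        (ENNReal.ofReal (1 - p₁) * ENNReal.ofReal x⁻¹ * ENNReal.ofReal h₀ +
          ENNReal.ofReal p₁ * ENNReal.ofReal x * ENNReal.ofReal h₁) * I n k 1 := by ring
      _ ≤ ENNReal.ofReal r * ENNReal.ofReal h₀ * I n k 0 +
        ENNReal.ofReal r * ENNReal.ofReal h₁ * I n k 1 := by gcongr
      _ = _ := by ring
  have hbound : ∀ k n, ENNReal.ofReal h₀ * I n k 0 + ENNReal.ofReal h₁ * I n k 1 ≤
      ENNReal.ofReal r ^ k * (ENNReal.ofReal h₀ + ENNReal.ofReal h₁) := by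
    intro k
    induction k with
    | zero =>
      intro n
      have : ∀ j, I n 0 j ≤ 1 := fun j => by
        simp only [hI, hf, backInc_zero, zpow_zero, ENNReal.ofReal_one, lintegral_one,
          Measure.restrict_apply_univ]
        exact prob_le_one
      rw [pow_zero, one_mul]
      exact add_le_add (mul_le_of_le_one_right' (this 0)) (mul_le_of_le_one_right' (this 1))
    | succ k ih =>
      intro n
      have h := hcontr (n - 1) k
      rw [sub_add_cancel] at h
      refine h.trans ?_
      rw [pow_succ', mul_assoc]
      gcongr
      exact ih (n - 1)
  have hprob : ∀ n k, L {y | 0 ≤ backInc y n k} ≤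
      ENNReal.ofReal r ^ k * (ENNReal.ofReal h₀ + ENNReal.ofReal h₁) := by
    intro n k
    refine le_trans ?_ (hbound k n)
    calc L {y | 0 ≤ backInc y n k} ≤ L {y | 1 ≤ f n k y} := by
          refine measure_mono fun y hy => ?_
          simp only [hf, Set.mem_ofPred_eq] at hy ⊢
          rw [ENNReal.one_le_ofReal]
          exact one_le_zpow₀ hx.le hy
      _ ≤ ∫⁻ y, f n k y ∂L := by
          simpa using mul_meas_ge_le_lintegral (μ := L) (hfm n k) 1
      _ = I n k 0 + I n k 1 := by
          rw [← Measure.restrict_univ (μ := L), restrict_eq_add_site L _ n,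
            lintegral_add_measure, Set.inter_univ, Set.inter_univ]
      _ ≤ _ := add_le_add
          (le_mul_of_one_le_left' (ENNReal.one_le_ofReal.2 hh0))
          (le_mul_of_one_le_left' (ENNReal.one_le_ofReal.2 hh1))
  refine ae_all_iff.2 fun n => ?_
  have hsum : ∑' k, L {y | 0 ≤ backInc y n k} ≠ ∞ := by
    refine ne_top_of_le_ne_top ?_ (ENNReal.tsum_le_tsum (hprob n))
    rw [ENNReal.tsum_mul_right, ENNReal.tsum_geometric]
    refine ENNReal.mul_ne_top (ENNReal.inv_ne_top.2 ?_) (by simp)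
    rw [← ENNReal.ofReal_one, ← ENNReal.ofReal_sub _ hr0]
    simpa using hr1
  filter_upwards [ae_eventually_notMem hsum] with y hy
  refine Filter.IsBoundedUnder.bddAbove_range ⟨0, Filter.eventually_map.2 ?_⟩
  filter_upwards [hy] with k hk
  exact (not_le.1 hk).le

/-! ### The carrier as a second-order Markov chain. -/

/-- The occupation number that the step from load `a` to load `b` reveals. -/
def upStep (a b : ℕ) : Fin 2 := if a < b then 1 else 0

/-- The transition weights of the carrier load, given its last two values. -/
noncomputable def loadWeight (p₀ p₁ : ℝ) (a b c : ℕ) : ℝ≥0∞ :=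
  if c = b + 1 then transProb p₀ p₁ (upStep a b) 1
  else if c = b - 1 then transProb p₀ p₁ (upStep a b) 0 else 0

theorem loadWeight_succ (p₀ p₁ : ℝ) (a b : ℕ) :
    loadWeight p₀ p₁ a b (b + 1) = transProb p₀ p₁ (upStep a b) 1 := if_pos rfl

theorem loadWeight_pred (p₀ p₁ : ℝ) (a b : ℕ) :
    loadWeight p₀ p₁ a b (b - 1) = transProb p₀ p₁ (upStep a b) 0 := by
  rw [loadWeight, if_neg (by omega), if_pos rfl]

theorem upStep_of_lt {a b : ℕ} (h : a < b) : upStep a b = 1 := if_pos h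

theorem upStep_of_le {a b : ℕ} (h : b ≤ a) : upStep a b = 0 := if_neg (by omega)

/-- The configuration whose particles are the up-steps of `z`. -/
def upSteps (z : ℤ → ℕ) (n : ℤ) : Fin 2 := upStep (z (n - 1)) (z n)

theorem measurable_upSteps : Measurable upSteps := by
  refine measurable_pi_lambda _ fun n => ?_
  have h : Measurable fun q : ℕ × ℕ => upStep q.1 q.2 := Measurable.of_discrete
  have h' : Measurable fun z : ℤ → ℕ => (z (n - 1), z n) :=
    (measurable_pi_apply (n - 1)).prodMk (measurable_pi_apply n)
  exact h.comp h'

theorem BddPast.upSteps_carrier {y : Config} (hy : BddPast y) : upSteps (carrier y) = y := by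
  funext n
  have := hy.eq_one_iff n
  unfold upSteps upStep
  split_ifs with h <;> simp only [h, iff_true, iff_false] at this <;> omega

/-- A down-step becomes an up-step when time runs backwards. The shift by -1 appears because a step
is indexed by its right endpoint, which reflection exchanges with the left one. -/
theorem bbs_eq_reverse (y : Config) :
    bbs y = seqShift (-1) (seqRev (upSteps (seqRev (carrier y)))) := by
  funext n
  change upStep (carrier y n) (carrier y (n - 1)) =
    upStep (carrier y (-(-(n + -1) - 1))) (carrier y (-(-(n + -1))))
  rw [show -(-(n + -1) - 1) = n by ring, show -(-(n + -1)) = n - 1 by ring]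

/-- The last two loads determine the occupation number at the last site, hence the law of the next
one, which in turn determines the next load. The load history depends only on sites up to the
present, so the Markov property of the chain applies. -/
theorem IsStationaryMarkovLaw.map_carrier_initCyl (hL : IsStationaryMarkovLaw L p₀ p₁)
    (hb : ∀ᵐ y ∂L, BddPast y) (n : ℕ) (u : ℕ → ℕ) :
    L.map carrier (initCyl (n + 2) u) =
      L.map carrier (initCyl (n + 1) u) * loadWeight p₀ p₁ (u n) (u (n + 1)) (u (n + 2)) := by
  rw [Measure.map_apply measurable_carrier (measurableSet_initCyl _ _),
    Measure.map_apply measurable_carrier (measurableSet_initCyl _ _)]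
  set A := carrier ⁻¹' initCyl (n + 1) u with hA
  have hAm : MeasurableSet A := measurable_carrier (measurableSet_initCyl _ _)
  have hApast : ∀ y z : Config, (∀ m ≤ (n + 1 : ℤ), y m = z m) → y ∈ A → z ∈ A := by
    intro y z h hy i hi
    rw [← hy i hi]
    exact (carrier_congr fun m hm => h m (by omega)).symm
  have hAi : ∀ y, BddPast y → y ∈ A → y (n + 1) = upStep (u n) (u (n + 1)) := by
    intro y hy hyA
    have h0 := hyA n (by omega)
    have h1 := hyA (n + 1) le_rfl
    rw [← hy.upSteps_carrier, upSteps, add_sub_cancel_right, ← h0, ← h1]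
    push_cast
    rfl
  have hcyl : ∀ y, y ∈ carrier ⁻¹' initCyl (n + 2) u ↔ y ∈ A ∧ carrier y (n + 1 + 1) = u (n + 2) := by
    intro y
    rw [show n + 2 = n + 1 + 1 from rfl, initCyl_succ]
    simp [hA]
  have hstep : ∀ y, BddPast y → y ∈ A →
      carrier y (n + 1 + 1) = loadStep (u (n + 1)) (y (n + 1 + 1)) := by
    intro y hy hyA
    have h1 := hyA (n + 1) le_rfl
    rw [hy.carrier_succ, ← h1]
    push_cast
    rfl
  have hA' : L A = L (A ∩ {y | y (n + 1) = upStep (u n) (u (n + 1))}) := by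
    refine measure_congr ?_
    filter_upwards [hb] with y hy
    exact propext ⟨fun h => ⟨h, hAi y hy h⟩, fun h => h.1⟩
  -- At most one occupation number leads to the prescribed next load; if none does, the cylinder is
  -- null.
  have hj : ∀ j, loadStep (u (n + 1)) j = u (n + 2) →
      (∀ j', loadStep (u (n + 1)) j' = u (n + 2) → j' = j) →
      L (carrier ⁻¹' initCyl (n + 2) u) = L A * transProb p₀ p₁ (upStep (u n) (u (n + 1))) j := by
    intro j hj hj'
    rw [hA', mul_comm, ← hL.measure_inter (n + 1) _ j hAm hApast]
    refine measure_congr ?_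
    filter_upwards [hb] with y hy
    refine propext ((hcyl y).trans ⟨fun h => ⟨h.1, hAi y hy h.1, ?_⟩, fun h => ⟨h.1, ?_⟩⟩)
    · exact hj' _ ((hstep y hy h.1).symm.trans h.2)
    · rw [hstep y hy h.1, ← hj, show y (n + 1 + 1) = j from h.2.2]
  unfold loadWeight
  unfold loadStep at hj hstep
  split_ifs with h1 h2
  · exact hj 1 (by simp [h1]) fun j' h => by split_ifs at h <;> omega
  · exact hj 0 (by simp [h2]) fun j' h => by split_ifs at h <;> omega
  · rw [mul_zero]
    refine measure_eq_zero_iff_ae_notMem.2 ?_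
    filter_upwards [hb] with y hy h
    obtain ⟨hyA, h⟩ := (hcyl y).1 h
    rw [hstep y hy hyA] at h
    split_ifs at h <;> omega

theorem IsStationaryMarkovLaw.map_carrier_shift (hL : IsStationaryMarkovLaw L p₀ p₁) (m : ℤ) :
    (L.map carrier).map (seqShift m) = L.map carrier := by
  rw [Measure.map_map (measurable_seqShift m) measurable_carrier]
  conv_rhs => rw [← hL.shift m, Measure.map_map measurable_carrier (measurable_seqShift m)]
  congr 1
  funext y
  exact (carrier_seqShift y m).symm

/-! ### Crossing balance, reversibility and invariance. -/

/-- In a stationary law, up-crossings and down-crossings of an event are equally likely. -/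
theorem measure_crossing_comm {α : Type*} [MeasurableSpace α] {Λ : Measure (ℤ → α)}
    [IsFiniteMeasure Λ] (hshift : ∀ m, Λ.map (seqShift m) = Λ) {B : Set α} (hB : MeasurableSet B) :
    Λ {z | z 0 ∈ B ∧ z 1 ∉ B} = Λ {z | z 0 ∉ B ∧ z 1 ∈ B} := by
  have hm : ∀ n : ℤ, MeasurableSet {z : ℤ → α | z n ∈ B} := fun n => measurable_pi_apply n hB
  have h01 : Λ {z | z 0 ∈ B} = Λ {z | z 1 ∈ B} := by
    conv_lhs => rw [← hshift 1, Measure.map_apply (measurable_seqShift 1) (hm 0)]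
    rfl
  rw [← measure_inter_add_sdiff {z | z 0 ∈ B} (hm 1),
    ← measure_inter_add_sdiff {z | z 1 ∈ B} (hm 0), Set.inter_comm,
    ENNReal.add_right_inj (measure_ne_top _ _)] at h01
  have hset : {z : ℤ → α | z 0 ∉ B ∧ z 1 ∈ B} = {z | z 1 ∈ B} \ {z | z 0 ∈ B} := by
    ext z
    exact and_comm
  rw [hset]
  exact h01

theorem IsStationaryMarkovLaw.measure_pair (hL : IsStationaryMarkovLaw L p₀ p₁) (i j : Fin 2) :
    L {y | y 0 = i ∧ y 1 = j} = transProb p₀ p₁ i j * L {y | y 0 = i} := by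
  have h := hL.measure_inter 0 i j (A := Set.univ) MeasurableSet.univ fun _ _ _ _ => trivial
  rw [Set.univ_inter, Set.univ_inter, zero_add] at h
  exact h

theorem IsStationaryMarkovLaw.measure_pair_comm (hL : IsStationaryMarkovLaw L p₀ p₁)
    (a b : Fin 2) : L {y | y 0 = a ∧ y 1 = b} = L {y | y 0 = b ∧ y 1 = a} := by
  have := hL.prob
  have h := measure_crossing_comm hL.shift (measurableSet_singleton (1 : Fin 2))
  have h10 : L {y | y 0 = 1 ∧ y 1 = 0} = L {y | y 0 = 0 ∧ y 1 = 1} := by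
    convert h using 2 <;> ext y <;> simp only [Set.mem_ofPred_eq, Set.mem_singleton_iff] <;> omega
  rcases Fin.exists_fin_two.1 ⟨a, rfl⟩ with rfl | rfl <;>
  rcases Fin.exists_fin_two.1 ⟨b, rfl⟩ with rfl | rfl
  · rfl
  · exact h10.symm
  · exact h10
  · rfl

theorem IsStationaryMarkovLaw.measure_initCyl (hL : IsStationaryMarkovLaw L p₀ p₁) (n : ℕ)
    (u : ℕ → Fin 2) :
    L (initCyl (n + 1) u) = L (initCyl n u) * transProb p₀ p₁ (u n) (u (n + 1)) := by
  have h := hL.measure_inter n (u n) (u (n + 1)) (measurableSet_initCyl n u)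
    fun y z hyz hy i hi => (hyz i (by omega)).symm.trans (hy i hi)
  have h1 : initCyl n u ∩ {y : Config | y n = u n} = initCyl n u :=
    Set.inter_eq_left.2 fun y hy => hy n le_rfl
  rw [← Set.inter_assoc, h1] at h
  rw [initCyl_succ, h, mul_comm]

/-- The stationary two-state chain is reversible. -/
theorem IsStationaryMarkovLaw.map_seqRev (hL : IsStationaryMarkovLaw L p₀ p₁) :
    L.map seqRev = L := by
  have := hL.prob
  refine map_seqRev_of_detailedBalance hL.shift (fun _ b c => transProb p₀ p₁ b c)
    (fun n u => hL.measure_initCyl (n + 1) u) hL.measure_pair_comm fun a b c => ?_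
  rw [hL.measure_pair_comm a, hL.measure_pair_comm c, hL.measure_pair, hL.measure_pair]
  ring

/-- The carrier load is reversible. -/
theorem IsStationaryMarkovLaw.map_carrier_seqRev (hL : IsStationaryMarkovLaw L p₀ p₁)
    (hp₀ : p₀ ∈ Set.Ioo (0 : ℝ) 1) (hp₁ : p₁ ∈ Set.Ioo (0 : ℝ) 1) (hb : ∀ᵐ y ∂L, BddPast y) :
    (L.map carrier).map seqRev = L.map carrier := by
  have := hL.prob
  set Λ := L.map carrier with hΛ
  have hshift : ∀ m, Λ.map (seqShift m) = Λ := hL.map_carrier_shift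
  set N : ℕ → ℕ → ℝ≥0∞ := fun a b => Λ {z | z 0 = a ∧ z 1 = b} with hN
  have hm : ∀ n c, MeasurableSet {z : ℤ → ℕ | z n = c} := fun n c =>
    measurableSet_eq_fun (measurable_pi_apply n) measurable_const
  have hstep : ∀ᵐ z ∂Λ, z 1 = z 0 + 1 ∨ z 1 = z 0 - 1 := by
    have hpair : Measurable fun z : ℤ → ℕ => (z 0, z 1) :=
      (measurable_pi_apply 0).prodMk (measurable_pi_apply 1)
    have hmeas : MeasurableSet {z : ℤ → ℕ | z 1 = z 0 + 1 ∨ z 1 = z 0 - 1} :=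
      hpair (MeasurableSet.of_discrete (s := {q : ℕ × ℕ | q.2 = q.1 + 1 ∨ q.2 = q.1 - 1}))
    refine (ae_map_iff measurable_carrier.aemeasurable hmeas).2 ?_
    filter_upwards [hb] with y hy
    have h := hy.carrier_succ 0
    rw [zero_add] at h
    unfold loadStep at h
    split_ifs at h <;> omega
  have hzero : ∀ a b, ¬(b = a + 1 ∨ b = a - 1) → N a b = 0 := by
    intro a b hab
    refine measure_eq_zero_iff_ae_notMem.2 ?_
    filter_upwards [hstep] with z hz h
    rw [h.1, h.2] at hz
    exact hab hz
  -- The load moves by at most one, so crossing the level `a` means stepping between `a` and `a +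
  -- 1`.
  have hup : ∀ a, N a (a + 1) = N (a + 1) a := by
    intro a
    have h := measure_crossing_comm hshift (B := Set.Iic a) measurableSet_Iic
    have h1 : N a (a + 1) = Λ {z | z 0 ∈ Set.Iic a ∧ z 1 ∉ Set.Iic a} := by
      refine measure_congr ?_
      filter_upwards [hstep] with z hz
      refine propext ⟨fun h => ?_, fun h => ?_⟩
      · change z 0 ≤ a ∧ ¬ z 1 ≤ a
        change z 0 = a ∧ z 1 = a + 1 at h
        omega
      · change z 0 = a ∧ z 1 = a + 1
        change z 0 ≤ a ∧ ¬ z 1 ≤ a at h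
        omega
    have h2 : N (a + 1) a = Λ {z | z 0 ∉ Set.Iic a ∧ z 1 ∈ Set.Iic a} := by
      refine measure_congr ?_
      filter_upwards [hstep] with z hz
      refine propext ⟨fun h => ?_, fun h => ?_⟩
      · change ¬ z 0 ≤ a ∧ z 1 ≤ a
        change z 0 = a + 1 ∧ z 1 = a at h
        omega
      · change z 0 = a + 1 ∧ z 1 = a
        change ¬ z 0 ≤ a ∧ z 1 ≤ a at h
        omega
    rw [h1, h2, h]
  have hsymm : ∀ a b, N a b = N b a := by
    intro a b
    rcases lt_trichotomy a b with h | rfl | h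
    · by_cases h' : b = a + 1
      · rw [h', hup]
      · rw [hzero a b (by omega), hzero b a (by omega)]
    · rfl
    · by_cases h' : a = b + 1
      · rw [h', hup]
      · rw [hzero a b (by omega), hzero b a (by omega)]
  have hthree : ∀ a b c, Λ {z | z 0 = a ∧ z 1 = b ∧ z 2 = c} =
      N a b * loadWeight p₀ p₁ a b c := by
    intro a b c
    have h := hL.map_carrier_initCyl hb 0 (fun i => if i = 0 then a else if i = 1 then b else c)
    rw [zero_add, zero_add, initCyl_succ, initCyl_one, ← hΛ] at h
    refine Eq.trans (congrArg Λ ?_) h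
    ext z
    exact and_assoc.symm
  have hpair : ∀ b c, N b c = Λ {z | z 1 = b ∧ z 2 = c} := by
    intro b c
    simp only [hN]
    conv_lhs => rw [← hshift 1, Measure.map_apply (measurable_seqShift 1)
      (show MeasurableSet {z : ℤ → ℕ | z 0 = b ∧ z 1 = c} from (hm 0 b).inter (hm 1 c))]
    rfl
  -- Decomposition over the predecessor of `b`; for `b = 0`, the value `b - 1 = 0` accounts for the
  -- load staying at 0.
  have hsplit : ∀ b c, N b c = N (b + 1) b * loadWeight p₀ p₁ (b + 1) b c +
      N (b - 1) b * loadWeight p₀ p₁ (b - 1) b c := by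
    intro b c
    rw [hpair, ← hthree, ← hthree, ← measure_union]
    · refine measure_congr ?_
      filter_upwards [hstep] with z hz
      refine propext ⟨fun h => ?_, fun h => ?_⟩
      · change (z 0 = b + 1 ∧ z 1 = b ∧ z 2 = c) ∨ (z 0 = b - 1 ∧ z 1 = b ∧ z 2 = c)
        change z 1 = b ∧ z 2 = c at h
        omega
      · change z 1 = b ∧ z 2 = c
        change (z 0 = b + 1 ∧ z 1 = b ∧ z 2 = c) ∨ (z 0 = b - 1 ∧ z 1 = b ∧ z 2 = c) at h
        omega
    · rw [Set.disjoint_left]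
      rintro z ⟨h1, -⟩ ⟨h2, -⟩
      omega
    · exact (hm 0 _).inter ((hm 1 _).inter (hm 2 _))
  have hadd := transProb_add p₀ p₁ hp₀ hp₁
  have hfin : ∀ a b i, N a b * transProb p₀ p₁ 0 i ≠ ∞ := fun a b i =>
    ENNReal.mul_ne_top (measure_ne_top _ _) ENNReal.ofReal_ne_top
  -- Steps from `w + 1` to `w + 2` are as frequent as steps back; splitting the former by
  -- predecessor and the latter by the row sum 1, the common term cancels.
  have hbal1 : ∀ w, N w (w + 1) * transProb p₀ p₁ 1 1 =
      N (w + 2) (w + 1) * transProb p₀ p₁ 0 0 := by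
    intro w
    have h := hsplit (w + 1) (w + 1 + 1)
    rw [loadWeight_succ, loadWeight_succ, Nat.add_sub_cancel, upStep_of_lt (a := w) (by omega),
      upStep_of_le (a := w + 1 + 1) (by omega), hup, add_comm] at h
    have h' : N (w + 2) (w + 1) * transProb p₀ p₁ 0 0 + N (w + 2) (w + 1) * transProb p₀ p₁ 0 1 =
        N (w + 2) (w + 1) := by
      rw [← mul_add, hadd, mul_one]
    rw [add_comm] at h h'
    exact ((ENNReal.add_right_inj (hfin _ _ _)).1 (h'.trans h)).symm
  -- The same cancellation at the boundary, applied to the steps from 0 to 0.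
  have hbal0 : N 1 0 * transProb p₀ p₁ 0 0 = N 0 0 * transProb p₀ p₁ 0 1 := by
    have h := hsplit 0 (0 - 1)
    rw [loadWeight_pred, loadWeight_pred, upStep_of_le (by omega), upStep_of_le (by omega),
      zero_add, Nat.zero_sub, add_comm] at h
    have h' : N 0 0 * transProb p₀ p₁ 0 0 + N 0 0 * transProb p₀ p₁ 0 1 = N 0 0 := by
      rw [← mul_add, hadd, mul_one]
    exact ((ENNReal.add_right_inj (hfin _ _ _)).1 (h'.trans h)).symm
  refine map_seqRev_of_detailedBalance hshift (loadWeight p₀ p₁) (hL.map_carrier_initCyl hb)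
    hsymm fun a b c => ?_
  change N a b * _ = N c b * _
  by_cases hab : b = a + 1 ∨ b = a - 1
  swap
  · rw [hzero a b hab, zero_mul, loadWeight, if_neg (by omega), if_neg (by omega), mul_zero]
  by_cases hcb : b = c + 1 ∨ b = c - 1
  swap
  · rw [hzero c b hcb, zero_mul, loadWeight, if_neg (by omega), if_neg (by omega), mul_zero]
  have hmain : ∀ b, N (b - 1) b * loadWeight p₀ p₁ (b - 1) b (b + 1) =
      N (b + 1) b * loadWeight p₀ p₁ (b + 1) b (b - 1) := by
    intro b
    rw [loadWeight_succ, loadWeight_pred, upStep_of_le (a := b + 1) (by omega)]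
    rcases b with _ | w
    · rw [upStep_of_le (by omega)]
      exact hbal0.symm
    · rw [Nat.add_sub_cancel, upStep_of_lt (by omega)]
      exact hbal1 w
  by_cases hac : a = c
  · rw [hac]
  by_cases ha : a = b + 1
  · obtain rfl : c = b - 1 := by omega
    rw [ha]
    exact (hmain b).symm
  · obtain rfl : a = b - 1 := by omega
    obtain rfl : c = b + 1 := by omega
    exact hmain b

theorem IsStationaryMarkovLaw.map_bbs (hL : IsStationaryMarkovLaw L p₀ p₁)
    (hp₀ : p₀ ∈ Set.Ioo (0 : ℝ) 1) (hp₁ : p₁ ∈ Set.Ioo (0 : ℝ) 1) (hb : ∀ᵐ y ∂L, BddPast y) :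
    L.map bbs = L := by
  have h1 : (L.map carrier).map upSteps = L := by
    rw [Measure.map_map measurable_upSteps measurable_carrier]
    conv_rhs => rw [← Measure.map_id (μ := L)]
    refine Measure.map_congr ?_
    filter_upwards [hb] with y hy
    exact hy.upSteps_carrier
  have h2 : bbs = seqShift (-1) ∘ seqRev ∘ upSteps ∘ seqRev ∘ carrier := funext bbs_eq_reverse
  rw [h2, ← Measure.map_map (measurable_seqShift _) (measurable_seqRev.comp
      (measurable_upSteps.comp (measurable_seqRev.comp measurable_carrier))),
    ← Measure.map_map measurable_seqRev
      (measurable_upSteps.comp (measurable_seqRev.comp measurable_carrier)),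
    ← Measure.map_map measurable_upSteps (measurable_seqRev.comp measurable_carrier),
    ← Measure.map_map measurable_seqRev measurable_carrier, hL.map_carrier_seqRev hp₀ hp₁ hb, h1,
    hL.map_seqRev, hL.shift]

/-! ### Moving the origin from a local maximum to the next local minimum. -/

theorem measurable_pathEncoding : Measurable pathEncoding := by
  refine measurable_pi_lambda _ fun n => ?_
  have h : ∀ k, Measurable fun y : Config => 1 - 2 * ((y k : ℕ) : ℤ) := fun k =>
    (Measurable.of_discrete (f := fun j : Fin 2 => 1 - 2 * ((j : ℕ) : ℤ))).comp
      (measurable_pi_apply k)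
  exact (Finset.measurable_fun_sum _ fun k _ => h k).sub (Finset.measurable_fun_sum _ fun k _ => h k)

theorem measurableSet_pair (i j : Fin 2) : MeasurableSet {y : Config | y 0 = i ∧ y 1 = j} :=
  (measurableSet_site 0 i).inter (measurableSet_site 1 j)

theorem measurableSet_runAfter (k : ℕ) : MeasurableSet (runAfter k) := by
  have h : MeasurableSet {y : Config | ∀ i ∈ Set.Icc (1 : ℤ) (k + 1), y i = 1} := by
    have : {y : Config | ∀ i ∈ Set.Icc (1 : ℤ) (k + 1), y i = 1} =
        ⋂ i, ⋂ _ : i ∈ Set.Icc (1 : ℤ) (k + 1), {y | y i = 1} := by ext y; simp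
    rw [this]
    exact MeasurableSet.iInter fun i => MeasurableSet.iInter fun _ => measurableSet_site _ _
  exact (measurableSet_site 0 0).inter (h.inter (measurableSet_site _ 0))

theorem measurableSet_runBefore (k : ℕ) : MeasurableSet (runBefore k) :=
  measurable_seqShift _ (measurableSet_runAfter k)

theorem seqShift_preimage_runBefore (k : ℕ) :
    seqShift (k + 1 : ℤ) ⁻¹' runBefore k = runAfter k := by
  ext y
  have : seqShift (-((k : ℤ) + 1)) (seqShift (k + 1 : ℤ) y) = y := by
    funext n
    simp only [seqShift]
    congr 1
    ring
  simp only [Set.mem_preimage, runBefore, Set.mem_ofPred_eq, this]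

theorem IsStationaryMarkovLaw.map_restrict_runAfter (hL : IsStationaryMarkovLaw L p₀ p₁) (k : ℕ) :
    (L.restrict (runAfter k)).map (seqShift (k + 1 : ℤ)) = L.restrict (runBefore k) := by
  rw [← seqShift_preimage_runBefore, ← Measure.restrict_map (measurable_seqShift _)
    (measurableSet_runBefore k), hL.shift]

theorem restrict_iUnion_runBefore (hb : ∀ᵐ y ∂L, BddPast y) :
    Measure.sum (fun k => L.restrict (runBefore k)) = L.restrict {y | y 0 = 1 ∧ y 1 = 0} := by
  rw [← Measure.restrict_iUnion pairwise_disjoint_runBefore measurableSet_runBefore]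
  refine Measure.restrict_congr_set ?_
  filter_upwards [hb] with y hy
  refine propext ⟨fun h => ?_, fun h => Set.mem_iUnion.2 (hy.exists_runBefore h.1 h.2)⟩
  obtain ⟨k, hk⟩ := Set.mem_iUnion.1 h
  exact runBefore_subset k hk

/-- Only backward runs are known to be finite, from the bounded past. By stationarity forward and
backward runs of each length are equally likely, and maxima and minima at 0 have equal mass, so
forward runs exhaust the maxima up to a null set. -/
theorem IsStationaryMarkovLaw.iUnion_runAfter_ae_eq (hL : IsStationaryMarkovLaw L p₀ p₁)
    (hb : ∀ᵐ y ∂L, BddPast y) : (⋃ k, runAfter k) =ᵐ[L] {y | y 0 = 0 ∧ y 1 = 1} := by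
  have := hL.prob
  refine ae_eq_of_subset_of_measure_ge (Set.iUnion_subset runAfter_subset) ?_
    (MeasurableSet.iUnion measurableSet_runAfter).nullMeasurableSet (measure_ne_top _ _)
  have h1 : ∀ k, L (runAfter k) = L (runBefore k) := fun k => by
    rw [← seqShift_preimage_runBefore, ← Measure.map_apply (measurable_seqShift _)
      (measurableSet_runBefore k), hL.shift]
  have h2 := congrArg (fun ν => ν Set.univ) (restrict_iUnion_runBefore hb)
  simp only [Measure.sum_apply _ MeasurableSet.univ, Measure.restrict_apply_univ] at h2
  rw [hL.measure_pair_comm, ← h2,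
    measure_iUnion pairwise_disjoint_runAfter measurableSet_runAfter]
  simp only [h1, le_refl]

theorem IsStationaryMarkovLaw.restrict_localMax (hL : IsStationaryMarkovLaw L p₀ p₁)
    (hb : ∀ᵐ y ∂L, BddPast y) :
    L.restrict {y | y 0 = 0 ∧ y 1 = 1} = Measure.sum fun k => L.restrict (runAfter k) := by
  rw [← Measure.restrict_iUnion pairwise_disjoint_runAfter measurableSet_runAfter]
  exact (Measure.restrict_congr_set (hL.iUnion_runAfter_ae_eq hb)).symm

theorem palmStep_ae_eq (hb : ∀ᵐ y ∂L, BddPast y) (k : ℕ) :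
    (fun y => palmStep (pathEncoding y)) =ᵐ[L.restrict (runAfter k)]
      (pathEncoding ∘ bbs) ∘ seqShift (k + 1 : ℤ) := by
  filter_upwards [ae_restrict_mem (measurableSet_runAfter k), ae_restrict_of_ae hb] with y hk hy
  exact palmStep_pathEncoding hy hk

/-- On each run length the map agrees almost everywhere with a measurable one, so measurability of
the suprema and infima over arbitrary paths is never needed. -/
theorem IsStationaryMarkovLaw.aemeasurable_palmStep (hL : IsStationaryMarkovLaw L p₀ p₁)
    (hb : ∀ᵐ y ∂L, BddPast y) :
    AEMeasurable (fun y => palmStep (pathEncoding y)) (L.restrict {y | y 0 = 0 ∧ y 1 = 1}) := by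
  rw [hL.restrict_localMax hb, aemeasurable_sum_measure_iff]
  exact fun k => ⟨_, (measurable_pathEncoding.comp measurable_bbs).comp (measurable_seqShift _),
    palmStep_ae_eq hb k⟩

/-- The restriction of the law to configurations with a local maximum at `0` is invariant under
the box-ball dynamics viewed from the next local maximum. -/
theorem IsStationaryMarkovLaw.map_palmStep (hL : IsStationaryMarkovLaw L p₀ p₁)
    (hp₀ : p₀ ∈ Set.Ioo (0 : ℝ) 1) (hp₁ : p₁ ∈ Set.Ioo (0 : ℝ) 1) (hb : ∀ᵐ y ∂L, BddPast y) :
    (L.restrict {y | y 0 = 0 ∧ y 1 = 1}).map (fun y => palmStep (pathEncoding y)) =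
      (L.restrict {y | y 0 = 0 ∧ y 1 = 1}).map pathEncoding := by
  have hm := measurable_pathEncoding.comp measurable_bbs
  have hae := hL.aemeasurable_palmStep hb
  rw [hL.restrict_localMax hb] at hae
  have hrun : ∀ k, (L.restrict (runAfter k)).map (fun y => palmStep (pathEncoding y)) =
      (L.restrict (runBefore k)).map (pathEncoding ∘ bbs) := fun k => by
    rw [Measure.map_congr (palmStep_ae_eq hb k), ← Measure.map_map hm (measurable_seqShift _),
      hL.map_restrict_runAfter]
  have hpre : L.restrict {y | y 0 = 1 ∧ y 1 = 0} =
      L.restrict (bbs ⁻¹' {y | y 0 = 0 ∧ y 1 = 1}) := by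
    refine Measure.restrict_congr_set ?_
    filter_upwards [hb] with y hy
    exact propext (hy.bbs_localMax_iff 0).symm
  calc _ = (Measure.sum fun k => L.restrict (runBefore k)).map (pathEncoding ∘ bbs) := by
        rw [hL.restrict_localMax hb, Measure.map_sum hae, Measure.map_sum hm.aemeasurable]
        simp only [hrun]
    _ = _ := by
        rw [restrict_iUnion_runBefore hb, hpre, ← Measure.map_map measurable_pathEncoding
          measurable_bbs, ← Measure.restrict_map measurable_bbs (measurableSet_pair 0 1),
          hL.map_bbs hp₀ hp₁ hb]

/-- Otherwise minima at 0 would be null too, and positivity of both off-diagonal transition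
probabilities would make both one-site events null. -/
theorem IsStationaryMarkovLaw.measure_localMax_pos (hL : IsStationaryMarkovLaw L p₀ p₁)
    (hp₀ : p₀ ∈ Set.Ioo (0 : ℝ) 1) (hp₁ : p₁ ∈ Set.Ioo (0 : ℝ) 1) :
    0 < L {y | y 0 = 0 ∧ y 1 = 1} := by
  have := hL.prob
  refine pos_iff_ne_zero.2 fun h => ?_
  have h' := h
  rw [hL.measure_pair_comm, hL.measure_pair] at h'
  rw [hL.measure_pair] at h
  have t01 : transProb p₀ p₁ 0 1 ≠ 0 := by simpa [transProb, transMatrix] using hp₀.1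
  have t10 : transProb p₀ p₁ 1 0 ≠ 0 := by simpa [transProb, transMatrix] using hp₁.2
  have h0 := (mul_eq_zero.1 h).resolve_left t01
  have h1 := (mul_eq_zero.1 h').resolve_left t10
  have huniv := restrict_eq_add_site L Set.univ 0
  rw [Set.inter_univ, Set.inter_univ, Measure.restrict_eq_zero.2 h0,
    Measure.restrict_eq_zero.2 h1, Measure.restrict_univ, add_zero] at huniv
  exact IsProbabilityMeasure.ne_zero L huniv

end BoxBall

theorem mainTheorem8 {Ω Ω' : Type*} [MeasurableSpace Ω] [MeasurableSpace Ω']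
    (μ : Measure Ω) [IsProbabilityMeasure μ] (ν : Measure Ω')
    (p₀ p₁ : ℝ) (hp₀ : p₀ ∈ Set.Ioo (0 : ℝ) 1) (hp₁ : p₁ ∈ Set.Ioo (0 : ℝ) 1)
    (hp : p₀ + p₁ < 1)
    (η : Ω → BoxBall.Config)
    (hη : BoxBall.IsStationaryMarkov μ (BoxBall.transMatrix p₀ p₁) η)
    -- `ηstar` has the law of `η` conditioned on its path encoding having a local maximum at `0`
    (ηstar : Ω' → BoxBall.Config)
    (hηstar : IdentDistrib ηstar η ν
      (ProbabilityTheory.cond μ {ω | (0 : ℤ) ∈ BoxBall.localMaxima (BoxBall.pathEncoding (η ω))})) :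
    -- the conditioning event has positive probability
    0 < μ {ω | (0 : ℤ) ∈ BoxBall.localMaxima (BoxBall.pathEncoding (η ω))} ∧
    -- almost surely `𝒯 S*` is well-defined: `M₀ < ∞` and `τ(T S*) < ∞`
    (∀ᵐ ω ∂ν,
      BddAbove (BoxBall.pathEncoding (ηstar ω) '' Set.Iic 0) ∧
      ∃ n : ℤ, 0 ≤ n ∧
        n ∈ BoxBall.localMaxima (BoxBall.pitman (BoxBall.pathEncoding (ηstar ω)))) ∧
    -- `𝒯 S*` and `S*` have the same law
    IdentDistrib (fun ω => BoxBall.palmStep (BoxBall.pathEncoding (ηstar ω)))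
      (fun ω => BoxBall.pathEncoding (ηstar ω)) ν ν := by
  have hL := hη.law
  have hb := hL.ae_bddPast hp₀ hp₁ hp
  have hE := BoxBall.measurableSet_pair 0 1
  have hset : {ω | (0 : ℤ) ∈ BoxBall.localMaxima (BoxBall.pathEncoding (η ω))} =
      η ⁻¹' {y | y 0 = 0 ∧ y 1 = 1} := by
    ext ω
    exact BoxBall.zero_mem_localMaxima_iff _
  -- The conditional law is a scalar multiple of the restricted law, so the unnormalised statements
  -- suffice.
  have hlaw : ν.map ηstar = (μ (η ⁻¹' {y | y 0 = 0 ∧ y 1 = 1}))⁻¹ •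
      (μ.map η).restrict {y | y 0 = 0 ∧ y 1 = 1} := by
    rw [hηstar.map_eq, hset, ProbabilityTheory.cond, Measure.map_smul,
      Measure.restrict_map hη.measurable hE]
  have hae := hηstar.aemeasurable_fst
  have hpalm : AEMeasurable (fun y => BoxBall.palmStep (BoxBall.pathEncoding y)) (ν.map ηstar) := by
    rw [hlaw]
    exact (hL.aemeasurable_palmStep hb).smul_measure _
  refine ⟨?_, ?_, ?_, ?_, ?_⟩
  · rw [hset, ← Measure.map_apply hη.measurable hE]
    exact hL.measure_localMax_pos hp₀ hp₁
  · refine ae_of_ae_map (p := fun y => BddAbove (BoxBall.pathEncoding y '' Set.Iic 0) ∧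
      ∃ n : ℤ, 0 ≤ n ∧ n ∈ BoxBall.localMaxima (BoxBall.pitman (BoxBall.pathEncoding y))) hae ?_
    rw [hlaw]
    refine Measure.ae_smul_measure ?_ _
    filter_upwards [ae_restrict_of_ae hb, ae_restrict_of_ae (hL.iUnion_runAfter_ae_eq hb),
      ae_restrict_mem hE] with y hy hy1 hy2
    obtain ⟨k, hk⟩ := Set.mem_iUnion.1 (hy1.mpr hy2)
    exact ⟨⟨_, (hy.isLUB_pathEncoding 0).1⟩, _, (BoxBall.firstLocalMax_pitman hy hk).1⟩
  · exact hpalm.comp_aemeasurable hae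
  · exact BoxBall.measurable_pathEncoding.comp_aemeasurable hae
  · have h1 := AEMeasurable.map_map_of_aemeasurable hpalm hae
    have h2 := AEMeasurable.map_map_of_aemeasurable
      BoxBall.measurable_pathEncoding.aemeasurable hae
    refine h1.symm.trans (Eq.trans ?_ h2)
    rw [hlaw, Measure.map_smul, Measure.map_smul, hL.map_palmStep hp₀ hp₁ hb]
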